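/- Let $\kappa$ be a field and $\mathbb{N}=\{0,1,2,\dots\}$. Let $S_1=\langle s_1,\dots,s_n\rangle$ and $S_2=\langle t_1,\dots,t_m\rangle$ be finitely generated submonoids of $\mathbb{N}^d$ (such monoids are exactly the affine semigroups in $\mathbb{N}^d$, and they are automatically positive, i.e. contain no nontrivial subgroup). For a submonoid $S\subseteq\mathbb{N}^d$ put $aS=\{as\mid s\in S\}$, let $\mathrm{gp}(S)$ be the subgroup of $\mathbb{Z}^d$ generated by $S$, and let $\kappa[\mathbf{u}^S]\subseteq\kappa[u_1,\dots,u_d]$ be the $\kappa$-algebra generated by the monomials $\mathbf{u}^s$, $s\in S$. Say that $S_1$ and $S_2$ *can be glued* if there are positive integers $a,b$ and monomials $X^p=X_1^{p_1}\cdots X_n^{p_n}$, $Y^q=Y_1^{q_1}\cdots Y_m^{q_m}$ such that the $\kappa$-algebra homomorphisms $$\varphi_1:\kappa[X_1,\dots,X_n]\to\kappa[\mathbf{u}^{aS_1}],\quad \varphi_2:\kappa[Y_1,\dots,Y_m]\to\kappa[\mathbf{u}^{bS_2}],\quad \varphi:\kappa[X_1,\dots,X_n,Y_1,\dots,Y_m]\to\kappa[\mathbf{u}^{aS_1+bS_2}]$$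 given by $\varphi(X_i)=\varphi_1(X_i)=\mathbf{u}^{as_i}$ and $\varphi(Y_j)=\varphi_2(Y_j)=\mathbf{u}^{bt_j}$ satisfy $\varphi_1(X^p)\neq 1$ and $$\ker\varphi=\ker\varphi_1+\ker\varphi_2+\langle X^p-Y^q\rangle$$ as ideals of $\kappa[X_1,\dots,X_n,Y_1,\dots,Y_m]$, where $\ker\varphi_1$ and $\ker\varphi_2$ stand for the ideals they generate there. **Theorem.** For every field $\kappa$ and every choice of generators $s_1,\dots,s_n$ of $S_1$ and $t_1,\dots,t_m$ of $S_2$, the semigroups $S_1$ and $S_2$ can be glued if and only if there are $a,b\in\mathbb{N}$ and a nonzero element $w\in aS_1\cap bS_2$ such that $w$ generates the group $\mathrm{gp}(aS_1)\cap\mathrm{gp}(bS_2)\subseteq\mathbb{Z}^d$. -/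

import Mathlib

namespace Gluing

open MvPolynomial

/-- The exponent lattice inclusion `ℕ^d → ℤ^d`. -/
noncomputable def toInt (d : ℕ) : (Fin d →₀ ℕ) →+ (Fin d →₀ ℤ) :=
  Finsupp.mapRange.addMonoidHom (Nat.castAddMonoidHom ℤ)

/-- The rescaling `aS = {a s | s ∈ S}` of a submonoid `S` of `ℕ^d`. -/
noncomputable def scale {d : ℕ} (a : ℕ) (S : AddSubmonoid (Fin d →₀ ℕ)) : AddSubmonoid (Fin d →₀ ℕ) :=
  S.map (nsmulAddMonoidHom a)

/-- The group of differences `gp(S)`, as a subgroup of `ℤ^d`. -/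
noncomputable def gp {d : ℕ} (S : AddSubmonoid (Fin d →₀ ℕ)) : AddSubgroup (Fin d →₀ ℤ) :=
  AddSubgroup.closure (toInt d '' (S : Set (Fin d →₀ ℕ)))

/-- The semigroup ring `κ[u^S]` inside the polynomial ring `κ[u] = κ[u_1, …, u_d]`: the subalgebra
generated by the monomials `u^s` with `s ∈ S`. -/
noncomputable def semigroupRing (κ : Type*) [Field κ] {d : ℕ} (S : AddSubmonoid (Fin d →₀ ℕ)) :
    Subalgebra κ (MvPolynomial (Fin d) κ) :=
  Algebra.adjoin κ ((fun s => monomial s (1 : κ)) '' (S : Set (Fin d →₀ ℕ)))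

/-- For a family `g` of vectors in `ℕ^d` generating the monoid `⟨g⟩`, the `κ`-algebra homomorphism
`κ[X_i : i ∈ ι] → κ[u^⟨g⟩]` that sends `X_i` to `u^(g i)`. -/
noncomputable def presentation (κ : Type*) [Field κ] {d : ℕ} {ι : Type*}
    (g : ι → (Fin d →₀ ℕ)) :
    MvPolynomial ι κ →ₐ[κ] semigroupRing κ (AddSubmonoid.closure (Set.range g)) :=
  aeval fun i => ⟨monomial (g i) 1,
    Algebra.subset_adjoin ⟨g i, AddSubmonoid.subset_closure ⟨i, rfl⟩, rfl⟩⟩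

/-- The semigroups `⟨s_1, …, s_n⟩` and `⟨t_1, …, t_m⟩` in `ℕ^d` can be glued (over `κ`): for some
positive integers `a, b`, with `φ₁ : X_i ↦ u^(a s_i)`, `φ₂ : Y_j ↦ u^(b t_j)` and `φ` the common
extension to `κ[X, Y]`, one has `ker φ = ker φ₁ + ker φ₂ + ⟨X^p - Y^q⟩` as ideals of `κ[X, Y]`, for
some monomials `X^p` and `Y^q`.  The element `φ₁(X^p)` along which the rings are glued is
a nonconstant monomial in `u`, i.e. it generates a polynomial ring in one variable. -/
def CanBeGlued (κ : Type*) [Field κ] {d n m : ℕ}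
    (s : Fin n → (Fin d →₀ ℕ)) (t : Fin m → (Fin d →₀ ℕ)) : Prop :=
  ∃ a b : ℕ, 0 < a ∧ 0 < b ∧ ∃ (p : Fin n →₀ ℕ) (q : Fin m →₀ ℕ),
    presentation κ (fun i => a • s i) (monomial p 1) ≠ 1 ∧
    RingHom.ker (presentation κ (Sum.elim (fun i => a • s i) (fun j => b • t j))) =
      (RingHom.ker (presentation κ (fun i => a • s i))).map
          (rename (Sum.inl : Fin n → Fin n ⊕ Fin m) : MvPolynomial (Fin n) κ →ₐ[κ] _)
      + (RingHom.ker (presentation κ (fun j => b • t j))).map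
          (rename (Sum.inr : Fin m → Fin n ⊕ Fin m) : MvPolynomial (Fin m) κ →ₐ[κ] _)
      + Ideal.span {rename Sum.inl (monomial p (1 : κ)) - rename Sum.inr (monomial q (1 : κ))}

end Gluing

namespace Gluing

open MvPolynomial

section

variable {d : ℕ} {ι : Type*}

/-! A toric ideal is determined by its homogeneous binomials, so gluing becomes a statement about
exponents. If X^u Y^v and X^u' Y^v' have equal degree, then deg u - deg u' = deg v' - deg v lies in
both groups of differences. When this intersection is generated by w = deg p = deg q, the difference
is k w, and k replacements of X^p by Y^q, or the reverse, connect the two monomials modulo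
`gluedIdeal` (`ker_le_gluedIdeal`). Conversely, grading by ℤ^d / ℤw with Y in degree 0 kills
`gluedIdeal`, so an equality of ideals forces every such difference into ℤw
(`gp_inf_gp_le_zmultiples`). -/

/-- The degree `∑ c i • g i` of the exponent vector `c` with respect to the family `g`. -/
noncomputable def weight (g : ι → (Fin d →₀ ℕ)) : (ι →₀ ℕ) →+ (Fin d →₀ ℕ) :=
  (Finsupp.linearCombination ℕ g).toAddMonoidHom

theorem mem_closure_range_iff_exists_weight (g : ι → (Fin d →₀ ℕ)) (x : Fin d →₀ ℕ) :
    x ∈ AddSubmonoid.closure (Set.range g) ↔ ∃ c, weight g c = x := by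
  rw [← Submodule.span_nat_eq_addSubmonoidClosure, Submodule.mem_toAddSubmonoid,
    Finsupp.mem_span_range_iff_exists_finsupp]
  rfl

theorem scale_closure_range (a : ℕ) (g : ι → (Fin d →₀ ℕ)) :
    scale a (AddSubmonoid.closure (Set.range g)) =
      AddSubmonoid.closure (Set.range fun i => a • g i) := by
  rw [scale, AddMonoidHom.map_mclosure, ← Set.range_comp]
  rfl

theorem toInt_injective : Function.Injective (toInt d) :=
  Finsupp.mapRange_injective _ (map_zero _) Nat.cast_injective

theorem mem_gp_iff_exists_sub (S : AddSubmonoid (Fin d →₀ ℕ)) (z : Fin d →₀ ℤ) :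
    z ∈ gp S ↔ ∃ x ∈ S, ∃ y ∈ S, z = toInt d x - toInt d y := by
  constructor
  · intro hz
    induction hz using AddSubgroup.closure_induction with
    | mem z hz =>
      obtain ⟨x, hx, rfl⟩ := hz
      exact ⟨x, hx, 0, S.zero_mem, by simp⟩
    | zero => exact ⟨0, S.zero_mem, 0, S.zero_mem, by simp⟩
    | add z z' _ _ h h' =>
      obtain ⟨x, hx, y, hy, rfl⟩ := h
      obtain ⟨x', hx', y', hy', rfl⟩ := h'
      refine ⟨x + x', S.add_mem hx hx', y + y', S.add_mem hy hy', ?_⟩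
      rw [map_add, map_add]
      abel
    | neg z _ h =>
      obtain ⟨x, hx, y, hy, rfl⟩ := h
      exact ⟨y, hy, x, hx, by abel⟩
  · rintro ⟨x, hx, y, hy, rfl⟩
    exact sub_mem (AddSubgroup.subset_closure ⟨x, hx, rfl⟩)
      (AddSubgroup.subset_closure ⟨y, hy, rfl⟩)

theorem mem_gp_closure_range_iff (g : ι → (Fin d →₀ ℕ)) (z : Fin d →₀ ℤ) :
    z ∈ gp (AddSubmonoid.closure (Set.range g)) ↔
      ∃ c c', z = toInt d (weight g c) - toInt d (weight g c') := by
  rw [mem_gp_iff_exists_sub]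
  constructor
  · rintro ⟨x, hx, y, hy, rfl⟩
    obtain ⟨c, rfl⟩ := (mem_closure_range_iff_exists_weight g x).1 hx
    obtain ⟨c', rfl⟩ := (mem_closure_range_iff_exists_weight g y).1 hy
    exact ⟨c, c', rfl⟩
  · rintro ⟨c, c', rfl⟩
    exact ⟨_, (mem_closure_range_iff_exists_weight g _).2 ⟨c, rfl⟩, _,
      (mem_closure_range_iff_exists_weight g _).2 ⟨c', rfl⟩, rfl⟩

/-! ### Toric ideals and their binomials -/

variable (κ : Type*) [Field κ]

theorem coe_presentation (g : ι → (Fin d →₀ ℕ)) (f : MvPolynomial ι κ) :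
    (presentation κ g f : MvPolynomial (Fin d) κ) = aeval (fun i => monomial (g i) (1 : κ)) f := by
  have : (Subalgebra.val _).comp (presentation κ g) =
      aeval (fun i => monomial (g i) (1 : κ)) := by
    ext i : 1
    simp [presentation]
  exact DFunLike.congr_fun this f

theorem mem_ker_presentation (g : ι → (Fin d →₀ ℕ)) (f : MvPolynomial ι κ) :
    f ∈ RingHom.ker (presentation κ g) ↔ aeval (fun i => monomial (g i) (1 : κ)) f = 0 := by
  rw [RingHom.mem_ker, ← coe_presentation, ZeroMemClass.coe_eq_zero]

theorem coe_presentation_monomial (g : ι → (Fin d →₀ ℕ)) (c : ι →₀ ℕ) :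
    (presentation κ g (monomial c 1) : MvPolynomial (Fin d) κ) = monomial (weight g c) 1 := by
  rw [coe_presentation, aeval_monomial, map_one, one_mul]
  simp only [monomial_pow, one_pow, Finsupp.prod]
  rw [← monomial_sum_one]
  rfl

theorem binomial_mem_ker_presentation (g : ι → (Fin d →₀ ℕ)) (c c' : ι →₀ ℕ) :
    monomial c (1 : κ) - monomial c' 1 ∈ RingHom.ker (presentation κ g) ↔
      weight g c = weight g c' := by
  rw [RingHom.mem_ker, map_sub, sub_eq_zero, Subtype.ext_iff, coe_presentation_monomial,
    coe_presentation_monomial]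
  exact (monomial_left_injective one_ne_zero).eq_iff

theorem presentation_monomial_eq_one_iff (g : ι → (Fin d →₀ ℕ)) (c : ι →₀ ℕ) :
    presentation κ g (monomial c 1) = 1 ↔ weight g c = 0 := by
  rw [Subtype.ext_iff, coe_presentation_monomial]
  exact (monomial_left_injective one_ne_zero).eq_iff (b := 0)

/-- The toric ideal is the smallest ideal containing all homogeneous binomials. -/
theorem ker_presentation_le (g : ι → (Fin d →₀ ℕ)) (I : Ideal (MvPolynomial ι κ))
    (hI : ∀ c c', weight g c = weight g c' → monomial c (1 : κ) - monomial c' 1 ∈ I) :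
    RingHom.ker (presentation κ g) ≤ I := by
  -- Send u^e to the class of one chosen monomial of degree e. The choice does not matter modulo
  -- `I`, so the quotient map factors through the presentation. Values at degrees that are not
  -- attained play no role.
  let σ : MvPolynomial (Fin d) κ →ₗ[κ] MvPolynomial ι κ ⧸ I :=
    (basisMonomials (Fin d) κ).constr κ fun e =>
      Ideal.Quotient.mkₐ κ I (monomial (Function.invFun (weight g) e) 1)
  have hσ : σ ∘ₗ (aeval fun i => monomial (g i) (1 : κ)).toLinearMap =
      (Ideal.Quotient.mkₐ κ I).toLinearMap := by
    refine (basisMonomials ι κ).ext fun c => ?_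
    have hc : monomial (weight g c) (1 : κ) = basisMonomials (Fin d) κ (weight g c) := by simp
    simp only [coe_basisMonomials, LinearMap.comp_apply, AlgHom.toLinearMap_apply]
    rw [← coe_presentation, coe_presentation_monomial, hc, Module.Basis.constr_basis]
    exact Ideal.Quotient.eq.2 (hI _ _ (Function.invFun_eq ⟨c, rfl⟩))
  intro f hf
  rw [mem_ker_presentation] at hf
  have := LinearMap.congr_fun hσ f
  simp only [LinearMap.comp_apply, AlgHom.toLinearMap_apply, hf, map_zero] at this
  exact Ideal.Quotient.eq_zero_iff_mem.1 this.symm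

/-! ### The glued ideal and the sufficiency of the lattice condition -/

variable {ι₁ ι₂ : Type*} (g₁ : ι₁ → (Fin d →₀ ℕ)) (g₂ : ι₂ → (Fin d →₀ ℕ))

theorem weight_elim_mapDomain_inl (c : ι₁ →₀ ℕ) :
    weight (Sum.elim g₁ g₂) (c.mapDomain Sum.inl) = weight g₁ c := by
  simp [weight, Finsupp.linearCombination_mapDomain]

theorem weight_elim_mapDomain_inr (c : ι₂ →₀ ℕ) :
    weight (Sum.elim g₁ g₂) (c.mapDomain Sum.inr) = weight g₂ c := by
  simp [weight, Finsupp.linearCombination_mapDomain]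

theorem exists_eq_mapDomain_inl_add_mapDomain_inr (c : ι₁ ⊕ ι₂ →₀ ℕ) :
    ∃ (u : ι₁ →₀ ℕ) (v : ι₂ →₀ ℕ), c = u.mapDomain Sum.inl + v.mapDomain Sum.inr := by
  induction c using Finsupp.induction_linear with
  | zero => exact ⟨0, 0, by simp⟩
  | add x y hx hy =>
    obtain ⟨u, v, rfl⟩ := hx
    obtain ⟨u', v', rfl⟩ := hy
    refine ⟨u + u', v + v', ?_⟩
    rw [Finsupp.mapDomain_add, Finsupp.mapDomain_add]
    abel
  | single i k =>
    rcases i with i | i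
    · exact ⟨Finsupp.single i k, 0, by simp⟩
    · exact ⟨0, Finsupp.single i k, by simp⟩

/-- The ideal `ker φ₁ + ker φ₂ + ⟨X^p - Y^q⟩` of `κ[X, Y]`. -/
noncomputable def gluedIdeal (p : ι₁ →₀ ℕ) (q : ι₂ →₀ ℕ) : Ideal (MvPolynomial (ι₁ ⊕ ι₂) κ) :=
  (RingHom.ker (presentation κ g₁)).map
      (rename (Sum.inl : ι₁ → ι₁ ⊕ ι₂) : MvPolynomial ι₁ κ →ₐ[κ] _)
    + (RingHom.ker (presentation κ g₂)).map
      (rename (Sum.inr : ι₂ → ι₁ ⊕ ι₂) : MvPolynomial ι₂ κ →ₐ[κ] _)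
    + Ideal.span {rename Sum.inl (monomial p (1 : κ)) - rename Sum.inr (monomial q (1 : κ))}

theorem gluedIdeal_le_iff (p : ι₁ →₀ ℕ) (q : ι₂ →₀ ℕ) (I : Ideal (MvPolynomial (ι₁ ⊕ ι₂) κ)) :
    gluedIdeal κ g₁ g₂ p q ≤ I ↔
      (∀ f ∈ RingHom.ker (presentation κ g₁), rename Sum.inl f ∈ I) ∧
      (∀ f ∈ RingHom.ker (presentation κ g₂), rename Sum.inr f ∈ I) ∧
      rename Sum.inl (monomial p (1 : κ)) - rename Sum.inr (monomial q (1 : κ)) ∈ I := by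
  rw [gluedIdeal, Submodule.add_eq_sup, Submodule.add_eq_sup, sup_le_iff, sup_le_iff,
    Ideal.map_le_iff_le_comap, Ideal.map_le_iff_le_comap, Ideal.span_singleton_le_iff_mem,
    and_assoc]
  rfl

theorem gluedIdeal_le_ker {p : ι₁ →₀ ℕ} {q : ι₂ →₀ ℕ} (h : weight g₁ p = weight g₂ q) :
    gluedIdeal κ g₁ g₂ p q ≤ RingHom.ker (presentation κ (Sum.elim g₁ g₂)) := by
  refine (gluedIdeal_le_iff κ g₁ g₂ p q _).2 ⟨fun f hf => ?_, fun f hf => ?_, ?_⟩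
  · rw [mem_ker_presentation] at hf ⊢
    rw [aeval_rename]
    exact hf
  · rw [mem_ker_presentation] at hf ⊢
    rw [aeval_rename]
    exact hf
  · rw [rename_monomial, rename_monomial, binomial_mem_ker_presentation,
      weight_elim_mapDomain_inl, weight_elim_mapDomain_inr, h]

theorem monomial_add_nsmul (c e : ι →₀ ℕ) (k : ℕ) :
    monomial (c + k • e) (1 : κ) = monomial c 1 * monomial e 1 ^ k := by
  rw [monomial_pow, one_pow, monomial_mul, one_mul]

/-- Moving a multiple of the gluing degree from one side to the other. -/
theorem binomial_mem_gluedIdeal {p : ι₁ →₀ ℕ} {q : ι₂ →₀ ℕ} {u u' : ι₁ →₀ ℕ} {v v' : ι₂ →₀ ℕ}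
    (k : ℕ) (hu : weight g₁ u = weight g₁ (u' + k • p))
    (hv : weight g₂ v' = weight g₂ (v + k • q)) :
    rename Sum.inl (monomial u (1 : κ)) * rename Sum.inr (monomial v (1 : κ)) -
      rename Sum.inl (monomial u' (1 : κ)) * rename Sum.inr (monomial v' (1 : κ)) ∈
        gluedIdeal κ g₁ g₂ p q := by
  obtain ⟨h₁, h₂, h₃⟩ := (gluedIdeal_le_iff κ g₁ g₂ p q _).1 le_rfl
  have hX := h₁ _ ((binomial_mem_ker_presentation κ g₁ _ _).2 hu)
  have hY := h₂ _ ((binomial_mem_ker_presentation κ g₂ _ _).2 hv)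
  rw [← Ideal.Quotient.eq_zero_iff_mem] at h₃ hX hY ⊢
  simp only [monomial_add_nsmul, map_sub, map_mul, map_pow, sub_eq_zero] at h₃ hX hY ⊢
  rw [hX, hY, h₃]
  ring

theorem ker_le_gluedIdeal {p : ι₁ →₀ ℕ} {q : ι₂ →₀ ℕ} (h : weight g₁ p = weight g₂ q)
    (hgp : gp (AddSubmonoid.closure (Set.range g₁)) ⊓ gp (AddSubmonoid.closure (Set.range g₂)) ≤
      AddSubgroup.zmultiples (toInt d (weight g₁ p))) :
    RingHom.ker (presentation κ (Sum.elim g₁ g₂)) ≤ gluedIdeal κ g₁ g₂ p q := by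
  refine ker_presentation_le κ _ _ fun c c' hc => ?_
  obtain ⟨u, v, rfl⟩ := exists_eq_mapDomain_inl_add_mapDomain_inr c
  obtain ⟨u', v', rfl⟩ := exists_eq_mapDomain_inl_add_mapDomain_inr c'
  simp only [map_add, weight_elim_mapDomain_inl, weight_elim_mapDomain_inr] at hc
  have hsplit (u : ι₁ →₀ ℕ) (v : ι₂ →₀ ℕ) :
      monomial (u.mapDomain Sum.inl + v.mapDomain Sum.inr) (1 : κ) =
        rename Sum.inl (monomial u (1 : κ)) * rename Sum.inr (monomial v (1 : κ)) := by
    rw [rename_monomial, rename_monomial, monomial_mul, one_mul]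
  rw [hsplit, hsplit]
  have hcZ := congrArg (toInt d) hc
  rw [map_add, map_add] at hcZ
  obtain ⟨k, hk⟩ := AddSubgroup.mem_zmultiples_iff.1 (hgp ⟨
    (mem_gp_closure_range_iff g₁ (toInt d (weight g₁ u) - toInt d (weight g₁ u'))).2
      ⟨u, u', rfl⟩,
    (mem_gp_closure_range_iff g₂ _).2 ⟨v', v, by
      rw [sub_eq_sub_iff_add_eq_add, hcZ, add_comm]⟩⟩)
  -- The sign of `k` tells which of the two monomials has the surplus of X-degree; in the negative
  -- case they swap roles.
  obtain ⟨k, rfl | rfl⟩ := k.eq_nat_or_neg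
  · have hu : weight g₁ u = weight g₁ (u' + k • p) := by
      apply toInt_injective
      rw [map_add, map_add, map_nsmul, map_nsmul, ← natCast_zsmul, hk]
      abel
    refine binomial_mem_gluedIdeal κ g₁ g₂ k hu ?_
    rw [hu, map_add, map_nsmul, add_assoc] at hc
    rw [← add_left_cancel hc, map_add, map_nsmul, h, add_comm]
  · have hu : weight g₁ u' = weight g₁ (u + k • p) := by
      apply toInt_injective
      rw [neg_smul, neg_eq_iff_eq_neg, natCast_zsmul] at hk
      rw [map_add, map_add, map_nsmul, map_nsmul, hk]
      abel
    rw [← neg_mem_iff, neg_sub]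
    refine binomial_mem_gluedIdeal κ g₁ g₂ k hu ?_
    rw [hu, map_add, map_nsmul, add_assoc] at hc
    rw [add_left_cancel hc, map_add, map_nsmul, h, add_comm]

/-! ### Necessity of the lattice condition, by a grading -/

/-- The grading of `κ[X, Y]` by `ℤ^d / H` with `X_i` in degree `g₁ i` and `Y_j` in degree `0`,
as a homomorphism into the group algebra. -/
noncomputable def leftGrading (H : AddSubgroup (Fin d →₀ ℤ)) :
    MvPolynomial (ι₁ ⊕ ι₂) κ →ₐ[κ] AddMonoidAlgebra κ ((Fin d →₀ ℤ) ⧸ H) :=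
  aeval (Sum.elim
    (fun i => AddMonoidAlgebra.single (QuotientAddGroup.mk' H (toInt d (g₁ i))) 1) fun _ => 1)

theorem leftGrading_rename_inl (H : AddSubgroup (Fin d →₀ ℤ)) (f : MvPolynomial ι₁ κ) :
    leftGrading κ g₁ (ι₂ := ι₂) H (rename Sum.inl f) =
      AddMonoidAlgebra.mapDomainAlgHom κ κ ((QuotientAddGroup.mk' H).comp (toInt d))
        (presentation κ g₁ f : MvPolynomial (Fin d) κ) := by
  rw [coe_presentation, leftGrading, aeval_rename]
  have : (aeval (R := κ) fun i =>
      AddMonoidAlgebra.single (QuotientAddGroup.mk' H (toInt d (g₁ i))) (1 : κ)) =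
      (AddMonoidAlgebra.mapDomainAlgHom κ κ ((QuotientAddGroup.mk' H).comp (toInt d))).comp
        (aeval fun i => monomial (g₁ i) (1 : κ)) := by
    ext i : 1
    rw [AlgHom.comp_apply, aeval_X, aeval_X]
    exact Eq.symm AddMonoidAlgebra.mapDomain_single
  exact DFunLike.congr_fun this f

/-- On the Y variables the grading map factors through evaluation at u = 1, hence it kills ker φ₂.
-/
theorem leftGrading_rename_inr (H : AddSubgroup (Fin d →₀ ℤ)) (f : MvPolynomial ι₂ κ) :
    leftGrading κ g₁ H (rename Sum.inr f) =
      aeval (fun _ => 1) (presentation κ g₂ f : MvPolynomial (Fin d) κ) := by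
  rw [coe_presentation, leftGrading, aeval_rename]
  have : (aeval fun _ => 1 : MvPolynomial ι₂ κ →ₐ[κ] AddMonoidAlgebra κ ((Fin d →₀ ℤ) ⧸ H)) =
      (aeval fun _ => 1).comp (aeval fun i => monomial (g₂ i) (1 : κ)) := by
    ext i : 1
    rw [AlgHom.comp_apply, aeval_X, aeval_X, aeval_monomial]
    simp [AddMonoidAlgebra.one_def]
  exact DFunLike.congr_fun this f

theorem leftGrading_rename_inl_monomial (H : AddSubgroup (Fin d →₀ ℤ)) (c : ι₁ →₀ ℕ) :
    leftGrading κ g₁ (ι₂ := ι₂) H (rename Sum.inl (monomial c 1)) =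
      AddMonoidAlgebra.single (QuotientAddGroup.mk' H (toInt d (weight g₁ c))) 1 := by
  rw [leftGrading_rename_inl, coe_presentation_monomial]
  exact AddMonoidAlgebra.mapDomain_single

theorem leftGrading_rename_inr_monomial (H : AddSubgroup (Fin d →₀ ℤ)) (c : ι₂ →₀ ℕ) :
    leftGrading κ g₁ H (rename Sum.inr (monomial c 1)) = 1 := by
  rw [leftGrading, aeval_rename, aeval_monomial]
  simp [AddMonoidAlgebra.one_def]

theorem gluedIdeal_le_ker_leftGrading (p : ι₁ →₀ ℕ) (q : ι₂ →₀ ℕ) :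
    gluedIdeal κ g₁ g₂ p q ≤ RingHom.ker
      (leftGrading κ g₁ (ι₂ := ι₂) (AddSubgroup.zmultiples (toInt d (weight g₁ p)))) := by
  refine (gluedIdeal_le_iff κ g₁ g₂ p q _).2 ⟨fun f hf => ?_, fun f hf => ?_, ?_⟩
  · rw [RingHom.mem_ker] at hf ⊢
    rw [leftGrading_rename_inl, hf, ZeroMemClass.coe_zero, map_zero]
  · rw [RingHom.mem_ker] at hf ⊢
    rw [leftGrading_rename_inr κ g₁ g₂, hf, ZeroMemClass.coe_zero, map_zero]
  · rw [RingHom.mem_ker, map_sub, leftGrading_rename_inl_monomial,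
      leftGrading_rename_inr_monomial, sub_eq_zero, AddMonoidAlgebra.one_def]
    congr 1
    exact (QuotientAddGroup.eq_zero_iff _).2 (AddSubgroup.mem_zmultiples _)

theorem gp_inf_gp_le_zmultiples {p : ι₁ →₀ ℕ} {q : ι₂ →₀ ℕ}
    (h : RingHom.ker (presentation κ (Sum.elim g₁ g₂)) ≤ gluedIdeal κ g₁ g₂ p q) :
    gp (AddSubmonoid.closure (Set.range g₁)) ⊓ gp (AddSubmonoid.closure (Set.range g₂)) ≤
      AddSubgroup.zmultiples (toInt d (weight g₁ p)) := by
  rintro z ⟨hz₁, hz₂⟩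
  obtain ⟨u, u', rfl⟩ := (mem_gp_closure_range_iff g₁ z).1 hz₁
  obtain ⟨v', v, hv⟩ := (mem_gp_closure_range_iff g₂ _).1 hz₂
  have hweight : weight g₁ u + weight g₂ v = weight g₁ u' + weight g₂ v' := by
    apply toInt_injective
    rw [map_add, map_add, add_comm (toInt d (weight g₁ u'))]
    exact sub_eq_sub_iff_add_eq_add.1 hv
  have hker : rename Sum.inl (monomial u (1 : κ)) * rename Sum.inr (monomial v (1 : κ)) -
      rename Sum.inl (monomial u' (1 : κ)) * rename Sum.inr (monomial v' (1 : κ)) ∈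
        RingHom.ker (presentation κ (Sum.elim g₁ g₂)) := by
    simp only [rename_monomial, monomial_mul, one_mul]
    rw [binomial_mem_ker_presentation]
    simpa only [map_add, weight_elim_mapDomain_inl, weight_elim_mapDomain_inr] using hweight
  have := gluedIdeal_le_ker_leftGrading κ g₁ g₂ p q (h hker)
  rw [RingHom.mem_ker, map_sub, map_mul, map_mul, leftGrading_rename_inr_monomial,
    leftGrading_rename_inr_monomial, mul_one, mul_one, leftGrading_rename_inl_monomial,
    leftGrading_rename_inl_monomial, sub_eq_zero] at this
  -- Distinct basis elements of the group algebra are never equal, so the degrees of `u` and `u'`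
  -- agree modulo ℤw.
  have := AddMonoidAlgebra.single_left_injective one_ne_zero this
  rw [← QuotientAddGroup.eq_zero_iff]
  exact (map_sub
    (QuotientAddGroup.mk' (AddSubgroup.zmultiples (toInt d (weight g₁ p)))) _ _).trans (sub_eq_zero.2 this)

end

end Gluing

theorem theorem5p3 (κ : Type*) [Field κ] {d n m : ℕ}
    (S₁ S₂ : AddSubmonoid (Fin d →₀ ℕ))
    (s : Fin n → (Fin d →₀ ℕ)) (hs : AddSubmonoid.closure (Set.range s) = S₁)
    (t : Fin m → (Fin d →₀ ℕ)) (ht : AddSubmonoid.closure (Set.range t) = S₂) :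
    Gluing.CanBeGlued κ s t ↔
      ∃ a b : ℕ, ∃ w ∈ Gluing.scale a S₁ ⊓ Gluing.scale b S₂, w ≠ 0 ∧
        AddSubgroup.zmultiples (Gluing.toInt d w) =
          Gluing.gp (Gluing.scale a S₁) ⊓ Gluing.gp (Gluing.scale b S₂) := by
  subst hs ht
  simp only [Gluing.scale_closure_range]
  constructor
  · rintro ⟨a, b, -, -, p, q, hp, hker⟩
    change _ = Gluing.gluedIdeal κ (fun i => a • s i) (fun j => b • t j) p q at hker
    have hpq : Gluing.weight (fun i => a • s i) p = Gluing.weight (fun j => b • t j) q := by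
      have := ((Gluing.gluedIdeal_le_iff κ _ _ p q _).1 hker.ge).2.2
      rwa [MvPolynomial.rename_monomial, MvPolynomial.rename_monomial,
        Gluing.binomial_mem_ker_presentation, Gluing.weight_elim_mapDomain_inl,
        Gluing.weight_elim_mapDomain_inr] at this
    have hmem₁ := (Gluing.mem_closure_range_iff_exists_weight (fun i => a • s i) _).2 ⟨p, rfl⟩
    have hmem₂ := (Gluing.mem_closure_range_iff_exists_weight (fun j => b • t j) _).2
      ⟨q, hpq.symm⟩
    refine ⟨a, b, Gluing.weight (fun i => a • s i) p, ⟨hmem₁, hmem₂⟩,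
      fun h => hp ((Gluing.presentation_monomial_eq_one_iff κ _ p).2 h),
      le_antisymm (AddSubgroup.zmultiples_le_of_mem ⟨?_, ?_⟩)
        (Gluing.gp_inf_gp_le_zmultiples κ _ _ hker.le)⟩
    · exact AddSubgroup.subset_closure ⟨_, hmem₁, rfl⟩
    · exact AddSubgroup.subset_closure ⟨_, hmem₂, rfl⟩
  · rintro ⟨a, b, w, ⟨hw₁, hw₂⟩, hw, hgp⟩
    obtain ⟨p, rfl⟩ := (Gluing.mem_closure_range_iff_exists_weight _ w).1 hw₁
    obtain ⟨q, hq⟩ := (Gluing.mem_closure_range_iff_exists_weight _ _).1 hw₂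
    refine ⟨a, b, Nat.pos_of_ne_zero ?_, Nat.pos_of_ne_zero ?_, p, q,
      fun h => hw ((Gluing.presentation_monomial_eq_one_iff κ _ p).1 h),
      le_antisymm (Gluing.ker_le_gluedIdeal κ _ _ hq.symm hgp.ge)
        (Gluing.gluedIdeal_le_ker κ _ _ hq.symm)⟩
    -- A zero scaling factor would collapse its semigroup to 0, contradicting `w ≠ 0`.
    · rintro rfl
      exact hw (by simp [Gluing.weight, Finsupp.linearCombination_apply])
    · rintro rfl
      exact hw (hq.symm.trans <| by simp [Gluing.weight, Finsupp.linearCombination_apply])
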